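/- Let $G$ be a (Hausdorff) locally compact abelian group with Haar measure $\mu_G$, and let $t\mapsto U(t)$ be a unitary representation of $G$ on a separable complex Hilbert space $\mathcal H$ (so $U(s+t)=U(s)U(t)$, $U(0)=I$, and $t\mapsto\langle U(t)x,y\rangle$ is continuous for all $x,y\in\mathcal H$). Let $\phi\in\mathcal H$ be such that $\{U(t)\phi\}_{t\in G}$ is a continuous frame for $\mathcal H$ with respect to $(G,\mu_G)$: there are constants $0<a\le b$ with $a\|x\|^2\le\int_G|\langle x,U(t)\phi\rangle|^2\,d\mu_G(t)\le b\|x\|^2$ for all $x\in\mathcal H$. Let $H$ be a countable discrete subgroup of $G$ and let $\Phi=\{\varphi_1,\dots,\varphi_N\}\subset\mathcal H$ be such that $\{U(h)\varphi_n\}_{h\in H;\,n=1,\dots,N}$ is a Riesz sequence in $\mathcal H$. Put $$\mathcal H_\Phi=\Big\{\sum_{n=1}^N\sum_{h\in H}x_n(h)U(h)\varphi_n:\ x_n\in\ell^2(H)\Big\},\qquad \mathcal H_{U,\phi,\Phi}=\{F_f:\ f\in\mathcal H_\Phi\},\quad F_f(t)=\langle f,U(t)\phi\rangle,\ t\in G,$$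 where $\mathcal H_{U,\phi,\Phi}$ is regarded as a subspace of $L^2(G)=L^2(G,\mu_G)$. Let $A=[a_{m,n}]$ be an $M\times N$ matrix with entries in $\ell^2(H)$. Let $\widehat H$ be the (compact) dual group of $H$ with normalized Haar measure, let $\widehat{\ }:\ell^2(H)\to L^2(\widehat H)$ be the Fourier transform, i.e. the isometric extension of $\widehat x(\xi)=\sum_{h\in H}x(h)\overline{\xi(h)}$, and let $\widehat A(\xi)=[\widehat a_{m,n}(\xi)]$ be the transfer matrix of $A$. Assume that the entries of $\widehat A$ are in $L^\infty(\widehat H)$ and that $$\operatorname*{ess\,inf}_{\xi\in\widehat H}\det\big[\widehat A(\xi)^*\widehat A(\xi)\big]>0.$$ For $F=F_f\in\mathcal H_{U,\phi,\Phi}$ with $f=\sum_{n=1}^N\sum_{h\in H}x_n(h)U(h)\varphi_n$ (the coefficients $x_n\in\ell^2(H)$ are uniquely determined by $F$) define the generalized samples $$\mathcal L_mF(t)=\sum_{n=1}^N\sum_{h\in H}a_{m,n}(t-h)\,x_n(h),\qquad t\in H,\ m=1,\dots,M.$$ Then there exist $M$ functions $S_1,\dots,S_M\in\mathcal H_{U,\phi,\Phi}$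 such that the sequence $\{S_m(\cdot-t)\}_{t\in H;\,m=1,\dots,M}$ is a frame for $\mathcal H_{U,\phi,\Phi}$ (with the inner product of $L^2(G)$), and such that for every $F\in\mathcal H_{U,\phi,\Phi}$ $$F(s)=\sum_{m=1}^M\sum_{t\in H}\mathcal L_mF(t)\,S_m(s-t),\qquad s\in G.$$ The series converges absolutely at every point $s\in G$, uniformly on $G$, and in the norm of $L^2(G)$. -/

import Mathlib

open MeasureTheory Filter Topology
open scoped ENNReal ComplexConjugate Matrix

noncomputable section

namespace FrameSampling

/-! ## The dual group of a discrete abelian group and the Fourier transform on `ℓ²` -/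

/-- `ℓ²(H)`, the square-summable complex families indexed by `H`. -/
abbrev Ell2 (H : Type*) : Type _ := lp (fun _ : H => ℂ) 2

/-- The dual group of the additive topological group `H`: its continuous characters
`H → 𝕋`, with the compact-open topology. -/
abbrev DualGroup (H : Type*) [AddCommGroup H] [TopologicalSpace H] : Type _ :=
  PontryaginDual (Multiplicative H)

instance instMeasurableSpaceDual (A : Type*) [CommGroup A] [TopologicalSpace A] :
    MeasurableSpace (PontryaginDual A) := borel _

instance instBorelSpaceDual (A : Type*) [CommGroup A] [TopologicalSpace A] :
    BorelSpace (PontryaginDual A) := ⟨rfl⟩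

section Fourier

variable {H : Type*} [AddCommGroup H] [TopologicalSpace H]

/-- The value `(h, ξ)` of the character `ξ` at `h`, as a complex number. -/
def pairing (h : H) (ξ : DualGroup H) : ℂ := (ξ (Multiplicative.ofAdd h) : ℂ)

theorem continuous_pairing (h : H) : Continuous (pairing h) := by
  unfold pairing
  have h1 : Continuous fun ξ : DualGroup H => ξ (Multiplicative.ofAdd h) := by
    have h2 : Continuous fun ξ : (Multiplicative H) →ₜ* Circle =>
        (ξ : C(Multiplicative H, Circle)) :=
      (ContinuousMonoidHom.isInducing_toContinuousMap (Multiplicative H) Circle).continuous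
    exact (continuous_eval_const (F := C(Multiplicative H, Circle))
      (Multiplicative.ofAdd h)).comp h2
  exact continuous_subtype_val.comp h1

theorem pairing_add (h k : H) (ξ : DualGroup H) :
    pairing (h + k) ξ = pairing h ξ * pairing k ξ := by
  simp [pairing, ofAdd_add, map_mul]

theorem pairing_mul (h : H) (ξ η : DualGroup H) :
    pairing h (ξ * η) = pairing h ξ * pairing h η := by
  have : (ξ * η) (Multiplicative.ofAdd h)
      = ξ (Multiplicative.ofAdd h) * η (Multiplicative.ofAdd h) := rfl
  simp [pairing, this]

theorem pairing_neg (h : H) (ξ : DualGroup H) : pairing (-h) ξ = conj (pairing h ξ) := by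
  rw [pairing, ofAdd_neg, map_inv, Circle.coe_inv_eq_conj, pairing]

variable [DiscreteTopology H]

variable (H)

/-- The Haar measure of the (compact) dual group, normalized to have total mass `1`. -/
def dualHaar : Measure (DualGroup H) := Measure.haarMeasure ⊤

instance instIsHaarMeasureDualHaar : (dualHaar H).IsHaarMeasure :=
  inferInstanceAs (Measure.haarMeasure _).IsHaarMeasure

instance instIsProbabilityMeasureDualHaar : IsProbabilityMeasure (dualHaar H) :=
  ⟨by simpa [dualHaar] using
    Measure.haarMeasure_self (K₀ := (⊤ : TopologicalSpace.PositiveCompacts (DualGroup H)))⟩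

variable {H}

/-- Characters separate the points of a discrete abelian group. -/
theorem exists_pairing_ne_one {h : H} (hh : h ≠ 0) : ∃ ξ : DualGroup H, pairing h ξ ≠ 1 := by
  obtain ⟨c, hc⟩ := CharacterModule.exists_character_apply_ne_zero_of_ne_zero hh
  let j : AddCircle (1 : ℚ) →+ AddCircle (1 : ℝ) :=
    QuotientAddGroup.map _ _ (Rat.castHom ℝ).toAddMonoidHom (by
      rintro x ⟨n, rfl⟩
      exact ⟨n, by simp⟩)
  have hj : ∀ x, j x = 0 → x = 0 := by
    intro x
    induction x using QuotientAddGroup.induction_on with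
    | H q =>
      intro hq
      have h1 : ((q : ℝ) : AddCircle (1 : ℝ)) = 0 := hq
      rw [AddCircle.coe_eq_zero_iff] at h1
      obtain ⟨n, hn⟩ := h1
      refine (AddCircle.coe_eq_zero_iff (p := (1 : ℚ))).2 ⟨n, ?_⟩
      have : ((n : ℚ) : ℝ) = (q : ℝ) := by simpa using hn
      have h2 : (n : ℚ) = q := by exact_mod_cast this
      simpa using h2
  let f : Multiplicative H →* Circle :=
    { toFun := fun x => AddCircle.toCircle (j (c x.toAdd))
      map_one' := by simp
      map_mul' := fun x y => by simp [AddCircle.toCircle_add] }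
  let ξ : DualGroup H := (⟨f, continuous_of_discreteTopology⟩ : Multiplicative H →ₜ* Circle)
  refine ⟨ξ, fun h1 => hc (hj _ ?_)⟩
  have h2 : (AddCircle.toCircle (j (c h)) : ℂ) = 1 := h1
  have h3 : AddCircle.toCircle (j (c h)) = 1 := Circle.ext (by simpa using h2)
  exact AddCircle.injective_toCircle one_ne_zero (by simpa using h3)

theorem integral_pairing {h : H} (hh : h ≠ 0) : ∫ ξ, pairing h ξ ∂(dualHaar H) = 0 := by
  obtain ⟨η, hη⟩ := exists_pairing_ne_one hh
  have h1 := integral_mul_left_eq_self (μ := dualHaar H) (pairing h) η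
  simp only [pairing_mul, integral_const_mul] at h1
  by_contra h0
  exact hη (mul_right_cancel₀ h0 (by rw [h1, one_mul]))

/-- The function `ξ ↦ conj (h, ξ) = (-h, ξ)`, as an element of `L²` of the dual group. -/
def charL2 (h : H) : Lp ℂ 2 (dualHaar H) :=
  ContinuousMap.toLp 2 (dualHaar H) ℂ ⟨pairing (-h), continuous_pairing (-h)⟩

theorem orthonormal_charL2 : Orthonormal ℂ (charL2 (H := H)) := by
  classical
  rw [orthonormal_iff_ite]
  intro h k
  rw [charL2, charL2, ContinuousMap.inner_toLp (dualHaar H)]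
  have h1 : ∀ ξ : DualGroup H, pairing (-k) ξ * conj (pairing (-h) ξ) = pairing (h - k) ξ := by
    intro ξ
    rw [← pairing_neg, neg_neg, ← pairing_add]
    congr 1
    abel
  simp only [ContinuousMap.coe_mk, h1]
  split_ifs with hk
  · subst hk
    simp [pairing]
  · exact integral_pairing (sub_ne_zero.2 hk)

/-- The Fourier transform `ℓ²(H) → L²(Ĥ)`: the isometric extension of
`x̂(ξ) = ∑ h, x h * conj (h, ξ)`, i.e. the sum of that series in `L²(Ĥ)`. -/
def fourier : Ell2 H →ₗᵢ[ℂ] Lp ℂ 2 (dualHaar H) :=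
  orthonormal_charL2.orthogonalFamily.linearIsometry

theorem hasSum_fourier (x : Ell2 H) : HasSum (fun h => x h • charL2 h) (fourier x) :=
  orthonormal_charL2.orthogonalFamily.hasSum_linearIsometry x

/-- The transfer matrix `Â(ξ) = [â_{m,n}(ξ)]`. -/
def transfer {M N : ℕ} (A : Matrix (Fin M) (Fin N) (Ell2 H)) (ξ : DualGroup H) :
    Matrix (Fin M) (Fin N) ℂ :=
  Matrix.of fun m n => (fourier (A m n) : DualGroup H → ℂ) ξ

/-- `δ_A = ess inf_ξ det (Â(ξ)* Â(ξ))` (the determinant is real, being that of a positive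
semidefinite matrix). -/
def stabilityConst {M N : ℕ} (A : Matrix (Fin M) (Fin N) (Ell2 H)) : ℝ :=
  essInf (fun ξ => ((transfer A ξ)ᴴ * transfer A ξ).det.re) (dualHaar H)

/-- The conditions on the matrix of a generalized stable sampling procedure: the transfer matrix
has entries in `L^∞(Ĥ)`, and `δ_A > 0`. -/
structure IsStable {M N : ℕ} (A : Matrix (Fin M) (Fin N) (Ell2 H)) : Prop where
  memLp_top : ∀ m n, MemLp (fun ξ => transfer A ξ m n) ∞ (dualHaar H)
  pos : 0 < stabilityConst A

end Fourier

/-- The matrix convolution `(A * x)(h) = ∑ h', A (h - h') x (h')`, written componentwise. -/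
def matConv {H : Type*} [AddCommGroup H] {M N : ℕ} (A : Matrix (Fin M) (Fin N) (Ell2 H))
    (x : Fin N → Ell2 H) (m : Fin M) (h : H) : ℂ :=
  ∑ n, ∑' h', A m n (h - h') * x n h'

/-! ## Frames -/

/-- `ψ : Ω → E` is a continuous frame for `E` with respect to `(Ω, μ)`. -/
def IsContinuousFrame {Ω E : Type*} [MeasurableSpace Ω] (μ : Measure Ω)
    [NormedAddCommGroup E] [InnerProductSpace ℂ E] (ψ : Ω → E) : Prop :=
  (∀ x : E, Measurable fun w => inner ℂ (ψ w) x) ∧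
  ∃ a b : ℝ, 0 < a ∧ a ≤ b ∧ ∀ x : E,
    ENNReal.ofReal (a * ‖x‖ ^ 2) ≤ ∫⁻ w, ‖inner ℂ (ψ w) x‖ₑ ^ 2 ∂μ ∧
    ∫⁻ w, ‖inner ℂ (ψ w) x‖ₑ ^ 2 ∂μ ≤ ENNReal.ofReal (b * ‖x‖ ^ 2)

/-- `v` is a Riesz sequence in `E`, i.e. a Riesz basis of its closed linear span. -/
def IsRieszSequence {ι E : Type*} [NormedAddCommGroup E] [InnerProductSpace ℂ E]
    (v : ι → E) : Prop :=
  ∃ a b : ℝ, 0 < a ∧ a ≤ b ∧ ∀ (s : Finset ι) (c : ι → ℂ),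
    a * ∑ i ∈ s, ‖c i‖ ^ 2 ≤ ‖∑ i ∈ s, c i • v i‖ ^ 2 ∧
    ‖∑ i ∈ s, c i • v i‖ ^ 2 ≤ b * ∑ i ∈ s, ‖c i‖ ^ 2

/-- The space of functions `V`, with the inner product of `L²(Ω, μ)`, has the family `S` as a
(discrete) frame: `V` consists of square-integrable functions, every `S i` lies in `V`, and
`a ‖F‖² ≤ ∑ i, |⟨F, S i⟩|² ≤ b ‖F‖²` for every `F ∈ V`. -/
def IsFrameInL2 {Ω ι : Type*} [MeasurableSpace Ω] (μ : Measure Ω)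
    (V : Submodule ℂ (Ω → ℂ)) (S : ι → Ω → ℂ) : Prop :=
  (∀ F ∈ V, MemLp F 2 μ) ∧ (∀ i, S i ∈ V) ∧
  ∃ a b : ℝ, 0 < a ∧ a ≤ b ∧ ∀ F ∈ V,
    ENNReal.ofReal a * eLpNorm F 2 μ ^ 2 ≤ ∑' i, ‖∫ w, F w * conj (S i w) ∂μ‖ₑ ^ 2 ∧
    ∑' i, ‖∫ w, F w * conj (S i w) ∂μ‖ₑ ^ 2 ≤ ENNReal.ofReal b * eLpNorm F 2 μ ^ 2

/-! ## Unitary representations and the spaces `ℋ_Φ` and `ℋ_{U,φ,Φ}` -/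

/-- A (weakly continuous) unitary representation of the topological group `G` on `E`. -/
structure UnitaryRep (G E : Type*) [AddCommGroup G] [TopologicalSpace G]
    [NormedAddCommGroup E] [InnerProductSpace ℂ E] where
  toFun : G → E ≃ₗᵢ[ℂ] E
  map_zero : ∀ x, toFun 0 x = x
  map_add : ∀ s t x, toFun (s + t) x = toFun s (toFun t x)
  continuous_inner : ∀ x y, Continuous fun t => inner ℂ (toFun t x) y

instance {G E : Type*} [AddCommGroup G] [TopologicalSpace G]
    [NormedAddCommGroup E] [InnerProductSpace ℂ E] :
    CoeFun (UnitaryRep G E) (fun _ => G → E ≃ₗᵢ[ℂ] E) := ⟨UnitaryRep.toFun⟩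

section Spaces

variable {G E : Type*} [AddCommGroup G] [TopologicalSpace G]
  [NormedAddCommGroup E] [InnerProductSpace ℂ E] (U : UnitaryRep G E)

/-- The family `{U(h) φ_n}`, for `h ∈ H` and `n = 1, …, N`. -/
def translates {N : ℕ} (H : AddSubgroup G) (Φ : Fin N → E) (p : Fin N × H) : E :=
  U (p.2 : G) (Φ p.1)

/-- `f = ∑ n, ∑ h, x_n(h) U(h) φ_n`, the series converging in `E`. -/
def IsExpansion {N : ℕ} {H : AddSubgroup G} (Φ : Fin N → E) (x : Fin N → Ell2 H) (f : E) :
    Prop :=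
  HasSum (fun p : Fin N × H => x p.1 p.2 • translates U H Φ p) f

variable {U} in
theorem IsExpansion.add {N : ℕ} {H : AddSubgroup G} {Φ : Fin N → E} {x y : Fin N → Ell2 H}
    {f g : E} (hf : IsExpansion U Φ x f) (hg : IsExpansion U Φ y g) :
    IsExpansion U Φ (x + y) (f + g) := by
  have := HasSum.add hf hg
  simpa only [IsExpansion, Pi.add_apply, lp.coeFn_add, add_smul] using this

variable {U} in
theorem IsExpansion.smul {N : ℕ} {H : AddSubgroup G} {Φ : Fin N → E} {x : Fin N → Ell2 H}
    {f : E} (c : ℂ) (hf : IsExpansion U Φ x f) : IsExpansion U Φ (c • x) (c • f) := by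
  have := HasSum.const_smul c hf
  simpa only [IsExpansion, Pi.smul_apply, lp.coeFn_smul, smul_eq_mul, mul_smul] using this

/-- `ℋ_Φ`: the sums `∑ n, ∑ h, x_n(h) U(h) φ_n` with `x_n ∈ ℓ²(H)`. -/
def spanPhi {N : ℕ} (H : AddSubgroup G) (Φ : Fin N → E) : Submodule ℂ E where
  carrier := {f | ∃ x : Fin N → Ell2 H, IsExpansion U Φ x f}
  zero_mem' := ⟨0, by simp [IsExpansion, hasSum_zero]⟩
  add_mem' := by
    rintro f g ⟨x, hx⟩ ⟨y, hy⟩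
    exact ⟨x + y, hx.add hy⟩
  smul_mem' := by
    rintro c f ⟨x, hx⟩
    exact ⟨c • x, hx.smul c⟩

/-- `f ↦ F_f`, where `F_f(t) = ⟨f, U(t) φ⟩`; the inner product is linear in `f`. -/
def voice (φ : E) : E →ₗ[ℂ] (G → ℂ) where
  toFun f t := inner ℂ (U t φ) f
  map_add' f g := by
    ext t
    simp
  map_smul' c f := by
    ext t
    simp

/-- `ℋ_{U,φ,Φ} = {F_f : f ∈ ℋ_Φ}`, a space of functions on `G`. -/
def voiceSpace {N : ℕ} (φ : E) (H : AddSubgroup G) (Φ : Fin N → E) : Submodule ℂ (G → ℂ) :=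
  (spanPhi U H Φ).map (voice U φ)

/-- `x` is the coefficient vector of `F ∈ ℋ_{U,φ,Φ}`: `F = F_f` with
`f = ∑ n, ∑ h, x_n(h) U(h) φ_n`. -/
def IsCoeff {N : ℕ} {H : AddSubgroup G} (φ : E) (Φ : Fin N → E) (F : G → ℂ)
    (x : Fin N → Ell2 H) : Prop :=
  ∃ f, IsExpansion U Φ x f ∧ voice U φ f = F

open Classical in
/-- The coefficient vector of `F ∈ ℋ_{U,φ,Φ}` (and `0` if `F` is not in that space). -/
def coeff {N : ℕ} (H : AddSubgroup G) (φ : E) (Φ : Fin N → E) (F : G → ℂ) : Fin N → Ell2 H :=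
  if h : ∃ x, IsCoeff U φ Φ F x then h.choose else 0

/-- The generalized samples `ℒ_m F(t) = (A * x)_m(t)`, `t ∈ H`, where `x` is the coefficient
vector of `F`. -/
def sample {M N : ℕ} {H : AddSubgroup G} (φ : E) (Φ : Fin N → E)
    (A : Matrix (Fin M) (Fin N) (Ell2 H)) (F : G → ℂ) (m : Fin M) (t : H) : ℂ :=
  matConv A (coeff U H φ Φ F) m t

/-- The coefficient vector is unique, so that the samples are well defined. -/
theorem coeff_eq [MeasurableSpace G] {μ : Measure G} {N : ℕ} {H : AddSubgroup G} {φ : E}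
    {Φ : Fin N → E} (hφ : IsContinuousFrame μ fun t => U t φ)
    (hΦ : IsRieszSequence (translates U H Φ)) {F : G → ℂ} {x : Fin N → Ell2 H}
    (hx : IsCoeff U φ Φ F x) : coeff U H φ Φ F = x := by
  classical
  have hex : ∃ y, IsCoeff U φ Φ F y := ⟨x, hx⟩
  rw [coeff, dif_pos hex]
  obtain ⟨g, hg, hgF⟩ := hex.choose_spec
  generalize hex.choose = y at hg
  obtain ⟨f, hf, hfF⟩ := hx
  have hfg : g = f := by
    obtain ⟨-, a, b, ha, -, h⟩ := hφ
    have h0 : ∀ t, inner ℂ (U t φ) (g - f) = 0 := by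
      intro t
      have := congrFun (hgF.trans hfF.symm) t
      simpa [inner_sub_right, sub_eq_zero, voice] using this
    have h1 := (h (g - f)).1
    simp only [h0] at h1
    have h2 : a * ‖g - f‖ ^ 2 ≤ 0 := by simpa using h1
    have h3 : ‖g - f‖ ^ 2 ≤ 0 := by
      by_contra h4
      push Not at h4
      have := mul_pos ha h4
      linarith
    have h5 : ‖g - f‖ = 0 := by nlinarith [norm_nonneg (g - f), sq_nonneg ‖g - f‖]
    exact sub_eq_zero.1 (norm_eq_zero.1 h5)
  subst hfg
  obtain ⟨a, b, ha, -, h⟩ := hΦ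
  have hz : HasSum (fun p : Fin N × H => (y p.1 p.2 - x p.1 p.2) • translates U H Φ p) 0 := by
    simpa [sub_smul] using HasSum.sub hg hf
  funext n
  ext k
  have hlim : Tendsto (fun s : Finset (Fin N × H) =>
      ‖∑ p ∈ s, (y p.1 p.2 - x p.1 p.2) • translates U H Φ p‖ ^ 2) atTop (𝓝 0) := by
    have := (Filter.Tendsto.norm hz).pow 2
    simpa using this
  have hle : a * ‖y n k - x n k‖ ^ 2 ≤ 0 := by
    refine ge_of_tendsto hlim ?_
    filter_upwards [eventually_ge_atTop {(n, k)}] with s hs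
    refine le_trans ?_ (h s fun p => y p.1 p.2 - x p.1 p.2).1
    refine mul_le_mul_of_nonneg_left ?_ ha.le
    exact Finset.single_le_sum (f := fun p : Fin N × H => ‖y p.1 p.2 - x p.1 p.2‖ ^ 2)
      (fun _ _ => sq_nonneg _) (Finset.singleton_subset_iff.1 hs)
  have h3 : ‖y n k - x n k‖ = 0 := by
    by_contra h4
    have : 0 < ‖y n k - x n k‖ ^ 2 := by positivity
    have := mul_pos ha this
    linarith
  exact sub_eq_zero.1 (norm_eq_zero.1 h3)

end Spaces

end FrameSampling

end

open FrameSampling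

open FrameSampling
noncomputable section

namespace FrameSampling

/-! ## Bounds for matrices acting on vectors -/

section MatrixBounds

variable {ι κ : Type*} [Fintype ι] [Fintype κ]

/-! The sampling problem is solved on the level of coefficients in `ℓ²` and then carried to
functions. By Parseval on the dual group, convolution by `A` becomes pointwise multiplication by the
transfer matrix. Bounded entries and a determinant bounded away from zero make this multiplication
bounded above and below, uniformly in `ξ` (`exists_le_sum_norm_sq_mulVec`, `exists_bounds_matConv`).
Hence sampling is an operator `L` on `ℓ²` that is bounded below and commutes with the translations
by `H`, and `B = (L†L)⁻¹L†` is a bounded left inverse that commutes with them too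
(`exists_equivariant_leftInverse`).

Let `T` be the synthesis operator of the Riesz sequence, and `V` the analysis operator `f ↦ F_f`
into `L²(G)`; both are bounded and bounded below. Expanding `L x` in the standard basis `e_p` gives
`T x = T B L x = ∑ p, (L x)_p • T B e_p`. By equivariance the vectors `T B e_p` are the
`U(t)`-orbits, `t ∈ H`, of the `M` vectors with `p = (m, 0)`, so the functions they define are
translates of `M` functions `S_m`. The map `f ↦ F_f` is continuous into the bounded functions and
into `L²(G)`, which gives both kinds of convergence.

For the frame property, put `D = V T B`. The inner products with the translates of the `S_m` are the
coordinates of `D†`, and every function of the space is `D (L x)` for some `x`. Since `D L = V T` is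
bounded below, `exists_bounds_adjoint` gives both frame bounds. -/

theorem sum_norm_sq_mulVec_le {X : Matrix ι κ ℂ} {K : ℝ} (hX : ∀ i j, ‖X i j‖ ≤ K)
    (v : κ → ℂ) :
    ∑ i, ‖(X *ᵥ v) i‖ ^ 2 ≤ Fintype.card ι * (Fintype.card κ * K ^ 2) * ∑ j, ‖v j‖ ^ 2 := by
  have h1 : ∀ i, ‖(X *ᵥ v) i‖ ^ 2 ≤ (Fintype.card κ * K ^ 2) * ∑ j, ‖v j‖ ^ 2 := by
    intro i
    calc ‖(X *ᵥ v) i‖ ^ 2 ≤ (∑ j, ‖X i j‖ * ‖v j‖) ^ 2 := by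
          gcongr
          refine (norm_sum_le _ _).trans (le_of_eq ?_)
          simp
      _ ≤ (∑ j, ‖X i j‖ ^ 2) * ∑ j, ‖v j‖ ^ 2 := Finset.sum_mul_sq_le_sq_mul_sq _ _ _
      _ ≤ _ := by
          gcongr
          calc ∑ j, ‖X i j‖ ^ 2 ≤ ∑ _j : κ, K ^ 2 := by
                gcongr with j
                exact hX i j
            _ = _ := by simp
  calc ∑ i, ‖(X *ᵥ v) i‖ ^ 2 ≤ ∑ _i : ι, (Fintype.card κ * K ^ 2) * ∑ j, ‖v j‖ ^ 2 := by
        gcongr with i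
        exact h1 i
    _ = _ := by simp [mul_assoc]

/-- Cramer's rule gives `adj(XᴴX) Xᴴ (X v) = det(XᴴX) v`. The matrix on the left has entries bounded
on the compact set of `X` with entries at most `K`, so one constant serves all such `X`. -/
theorem exists_le_sum_norm_sq_mulVec [DecidableEq κ] (K : ℝ) {δ : ℝ} (hδ : 0 < δ) :
    ∃ c : ℝ, 0 < c ∧ ∀ X : Matrix ι κ ℂ, (∀ i j, ‖X i j‖ ≤ K) → δ ≤ (Xᴴ * X).det.re →
      ∀ v : κ → ℂ, c * ∑ j, ‖v j‖ ^ 2 ≤ ∑ i, ‖(X *ᵥ v) i‖ ^ 2 := by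
  have hcomp : IsCompact {X : Matrix ι κ ℂ | ∀ i j, X i j ∈ Metric.closedBall (0 : ℂ) K} := by
    have := isCompact_univ_pi (ι := ι) (X := fun _ => κ → ℂ) fun _ =>
      isCompact_univ_pi (ι := κ) fun _ => isCompact_closedBall (0 : ℂ) K
    convert! this using 1
    ext X
    exact ⟨fun h i _ j _ => h i j, fun h i j => h i trivial j trivial⟩
  have hbd : ∀ p : κ × ι, ∃ C : ℝ, ∀ X : Matrix ι κ ℂ, (∀ i j, ‖X i j‖ ≤ K) →
      ‖((Xᴴ * X).adjugate * Xᴴ) p.1 p.2‖ ≤ C := by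
    intro p
    have hc : Continuous fun X : Matrix ι κ ℂ => ((Xᴴ * X).adjugate * Xᴴ) p.1 p.2 := by
      have h0 : Continuous fun X : Matrix ι κ ℂ => Xᴴ := continuous_id.matrix_conjTranspose
      exact (((h0.matrix_mul continuous_id).matrix_adjugate).matrix_mul h0).matrix_elem _ _
    obtain ⟨C, hC⟩ := hcomp.exists_bound_of_continuousOn hc.continuousOn
    exact ⟨C, fun X hX => hC X fun i j => by simpa using hX i j⟩
  choose C hC using hbd
  set K2 : ℝ := ∑ p, |C p|
  have hK2 : ∀ X : Matrix ι κ ℂ, (∀ i j, ‖X i j‖ ≤ K) →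
      ∀ j i, ‖((Xᴴ * X).adjugate * Xᴴ) j i‖ ≤ K2 := fun X hX j i =>
    (hC (j, i) X hX).trans <| (le_abs_self _).trans <|
      Finset.single_le_sum (f := fun p => |C p|) (fun _ _ => abs_nonneg _) (Finset.mem_univ (j, i))
  set R : ℝ := Fintype.card κ * (Fintype.card ι * K2 ^ 2)
  have hR : 0 ≤ R := by positivity
  -- `R` bounds the squared norm of `adj(XᴴX) Xᴴ`; adding `1` keeps the denominator positive when `R
  -- = 0`.
  refine ⟨δ ^ 2 / (R + 1), by positivity, fun X hX hdet v => ?_⟩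
  have h1 := sum_norm_sq_mulVec_le (hK2 X hX) (X *ᵥ v)
  have h2 : ((Xᴴ * X).adjugate * Xᴴ) *ᵥ (X *ᵥ v) = (Xᴴ * X).det • v := by
    rw [Matrix.mulVec_mulVec, Matrix.mul_assoc, Matrix.adjugate_mul, Matrix.smul_mulVec,
      Matrix.one_mulVec]
  rw [h2] at h1
  have h3 : δ ≤ ‖(Xᴴ * X).det‖ := hdet.trans ((le_abs_self _).trans (Complex.abs_re_le_norm _))
  have h4 : δ ^ 2 * ∑ j, ‖v j‖ ^ 2 ≤ ∑ j, ‖((Xᴴ * X).det • v) j‖ ^ 2 := by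
    simp only [Pi.smul_apply, smul_eq_mul, norm_mul, mul_pow, ← Finset.mul_sum]
    gcongr
  have h5 : 0 ≤ ∑ i, ‖(X *ᵥ v) i‖ ^ 2 := by positivity
  rw [div_mul_eq_mul_div, div_le_iff₀ (by positivity)]
  linarith

end MatrixBounds

/-! ## Parseval's identity on the dual group -/

section Parseval

variable {H : Type*} [AddCommGroup H] [TopologicalSpace H]

theorem norm_pairing (h : H) (ξ : DualGroup H) : ‖pairing h ξ‖ = 1 := Circle.norm_coe _

/-- The pairing with `h`, as a continuous function on the dual group. -/
def pairingC (h : H) : C(DualGroup H, ℂ) := ⟨pairing h, continuous_pairing h⟩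

/-- The star algebra of trigonometric polynomials on the dual group. -/
def trigPolynomials (H : Type*) [AddCommGroup H] [TopologicalSpace H] :
    StarSubalgebra ℂ C(DualGroup H, ℂ) where
  toSubalgebra := Algebra.adjoin ℂ (Set.range (pairingC (H := H)))
  star_mem' := by
    change Algebra.adjoin ℂ (Set.range (pairingC (H := H))) ≤
      star (Algebra.adjoin ℂ (Set.range (pairingC (H := H))))
    refine Algebra.adjoin_le ?_
    rintro - ⟨h, rfl⟩
    exact Algebra.subset_adjoin ⟨-h, ContinuousMap.ext fun ξ => pairing_neg h ξ⟩

/-- Characters are closed under products and include the constant `1`, so generating an algebra adds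
nothing to their linear span. -/
theorem trigPolynomials_coe :
    Subalgebra.toSubmodule (trigPolynomials H).toSubalgebra =
      Submodule.span ℂ (Set.range (pairingC (H := H))) := by
  apply Algebra.adjoin_eq_span_of_subset
  refine Set.Subset.trans ?_ Submodule.subset_span
  intro x hx
  refine Submonoid.closure_induction (fun _ => id) ⟨0, ?_⟩ ?_ hx
  · ext ξ
    simp [pairingC, pairing]
  · rintro - - - - ⟨h, rfl⟩ ⟨k, rfl⟩
    exact ⟨h + k, ContinuousMap.ext fun ξ => pairing_add h k ξ⟩

theorem trigPolynomials_separatesPoints : (trigPolynomials H).SeparatesPoints := by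
  intro ξ η hne
  obtain ⟨h, hh⟩ : ∃ h : H, pairing h ξ ≠ pairing h η := by
    by_contra! hall
    refine hne (ContinuousMonoidHom.ext fun x => Circle.ext ?_)
    exact hall x.toAdd
  exact ⟨_, ⟨pairingC h, Algebra.subset_adjoin ⟨h, rfl⟩, rfl⟩, hh⟩

variable [DiscreteTopology H]

/-- Stone–Weierstrass: the dual group is compact, and evaluations at points of `H` separate its
elements. -/
theorem span_pairingC_closure_eq_top :
    (Submodule.span ℂ (Set.range (pairingC (H := H)))).topologicalClosure = ⊤ := by
  rw [← trigPolynomials_coe]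
  exact congrArg (Subalgebra.toSubmodule <| StarSubalgebra.toSubalgebra ·)
    (ContinuousMap.starSubalgebra_topologicalClosure_eq_top_of_separatesPoints _
      trigPolynomials_separatesPoints)

instance instRegularDualHaar : (dualHaar H).Regular :=
  inferInstanceAs (Measure.haarMeasure _).Regular

theorem span_charL2_closure_eq_top :
    (Submodule.span ℂ (Set.range (charL2 (H := H)))).topologicalClosure = ⊤ := by
  have h1 := (ContinuousMap.toLp_denseRange ℂ (dualHaar H) ℂ
    (ENNReal.ofNat_ne_top (n := 2))).topologicalClosure_map_submodule
      (span_pairingC_closure_eq_top (H := H))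
  have h2 : Set.range (charL2 (H := H)) =
      (ContinuousMap.toLp (E := ℂ) 2 (dualHaar H) ℂ) '' Set.range (pairingC (H := H)) := by
    -- `charL2 h` is the class of the pairing with `-h`, so the two families agree only after
    -- negating the index.
    rw [← Set.range_comp, ← (Equiv.neg H).surjective.range_comp (_ ∘ pairingC)]
    rfl
  rw [h2]
  rw [Submodule.map_span] at h1
  exact h1

/-- The characters, as a Hilbert basis of `L²` of the dual group. -/
def charBasis (H : Type*) [AddCommGroup H] [TopologicalSpace H] [DiscreteTopology H] :
    HilbertBasis H ℂ (Lp ℂ 2 (dualHaar H)) :=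
  HilbertBasis.mk orthonormal_charL2 span_charL2_closure_eq_top.ge

theorem hasSum_norm_sq_inner_charL2 (g : Lp ℂ 2 (dualHaar H)) :
    HasSum (fun h => ‖inner ℂ (charL2 h) g‖ ^ 2) (‖g‖ ^ 2) := by
  have h1 := lp.hasSum_norm (p := 2) (by norm_num) ((charBasis H).repr g)
  simpa [HilbertBasis.repr_apply_apply, charBasis] using h1

theorem inner_charL2_fourier (k : H) (a : Ell2 H) : inner ℂ (charL2 k) (fourier a) = a k := by
  classical
  have h1 := (hasSum_fourier a).mapL (innerSL ℂ (charL2 k))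
  refine h1.unique ?_
  have h2 := hasSum_single (f := fun h => innerSL ℂ (charL2 k) (a h • charL2 h)) k ?_
  · simpa [inner_smul_right, orthonormal_charL2.1 k] using h2
  · intro h hh
    simp [orthonormal_iff_ite.1 orthonormal_charL2, hh.symm]

theorem charL2_coeFn (h : H) : charL2 h =ᵐ[dualHaar H] pairing (-h) :=
  ContinuousMap.coeFn_toLp (dualHaar H) _

theorem inner_charL2 (h : H) (g : Lp ℂ 2 (dualHaar H)) :
    inner ℂ (charL2 h) g = ∫ ξ, pairing h ξ * g ξ ∂(dualHaar H) := by
  rw [L2.inner_def]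
  refine integral_congr_ae ?_
  filter_upwards [charL2_coeFn h] with ξ hξ
  rw [hξ, pairing_neg]
  simp [mul_comm]

/-- A convolution of `ℓ²` sequences is the sequence of Fourier coefficients of the product
of the transforms. -/
theorem hasSum_conv (a x : Ell2 H) (t : H) :
    HasSum (fun h => a (t - h) * x h)
      (∫ ξ, pairing t ξ * (fourier a ξ * fourier x ξ) ∂(dualHaar H)) := by
  -- The integral is the `L²` inner product of this function with the transform of `x`; expanding
  -- the latter in characters gives the convolution term by term. No boundedness of the transform of
  -- `a` is needed.
  have hw : MemLp (fun ξ => conj (pairing t ξ * fourier a ξ)) 2 (dualHaar H) := by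
    refine (Lp.memLp (fourier a)).of_le ?_ ?_
    · exact Complex.continuous_conj.comp_aestronglyMeasurable
        ((continuous_pairing t).aestronglyMeasurable.mul (Lp.aestronglyMeasurable _))
    · exact Eventually.of_forall fun ξ => by simp [norm_pairing]
  have h1 : HasSum (fun h => inner ℂ (hw.toLp _) (x h • charL2 h))
      (inner ℂ (hw.toLp _) (fourier x)) := (hasSum_fourier x).mapL (innerSL ℂ (hw.toLp _))
  have h2 : ∀ h, inner ℂ (hw.toLp _) (x h • charL2 h) = a (t - h) * x h := by
    intro h
    rw [inner_smul_right, mul_comm, ← inner_charL2_fourier (t - h) a, inner_charL2,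
      L2.inner_def]
    congr 1
    refine integral_congr_ae ?_
    filter_upwards [charL2_coeFn h, hw.coeFn_toLp] with ξ h2 h3
    rw [h2, h3, sub_eq_add_neg, pairing_add]
    simp
    ring
  have h3 : inner ℂ (hw.toLp _) (fourier x) =
      ∫ ξ, pairing t ξ * (fourier a ξ * fourier x ξ) ∂(dualHaar H) := by
    rw [L2.inner_def]
    refine integral_congr_ae ?_
    filter_upwards [hw.coeFn_toLp] with ξ h3
    rw [h3]
    simp
    ring
  simpa only [h2, h3] using h1

end Parseval

/-! ## Bounds for matrix convolution -/

section Convolution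

variable {H : Type*} [AddCommGroup H] [TopologicalSpace H] [DiscreteTopology H] {M N : ℕ}
  {A : Matrix (Fin M) (Fin N) (Ell2 H)}

theorem memLp_transfer_mulVec (hA : IsStable A) (x : Fin N → Ell2 H) (m : Fin M) :
    MemLp (fun ξ => (transfer A ξ *ᵥ fun n => fourier (x n) ξ) m) 2 (dualHaar H) := by
  refine memLp_finsetSum (Finset.univ : Finset (Fin N)) fun n _ => ?_
  exact (Lp.memLp (fourier (x n))).mul (hA.memLp_top m n)

/-- Bounded entries keep the product of the transfer matrix with the transforms in `L²`, so the
samples are Fourier coefficients of an `L²` function and Parseval applies to them. -/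
theorem matConv_eq_inner (hA : IsStable A) (x : Fin N → Ell2 H) (m : Fin M) (t : H) :
    matConv A x m t = inner ℂ (charL2 t) ((memLp_transfer_mulVec hA x m).toLp _) := by
  rw [inner_charL2, matConv]
  have h1 : ∫ ξ, pairing t ξ *
      (((memLp_transfer_mulVec hA x m).toLp _ : Lp ℂ 2 (dualHaar H)) : DualGroup H → ℂ) ξ ∂(dualHaar H) =
      ∫ ξ, ∑ n, pairing t ξ * (fourier (A m n) ξ * fourier (x n) ξ) ∂(dualHaar H) := by
    refine integral_congr_ae ?_
    filter_upwards [(memLp_transfer_mulVec hA x m).coeFn_toLp] with ξ h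
    rw [h, ← Finset.mul_sum]
    rfl
  rw [h1, integral_finsetSum]
  · exact Finset.sum_congr rfl fun n _ => (hasSum_conv _ _ _).tsum_eq
  · intro n _
    have h2 : MemLp (fun ξ => fourier (A m n) ξ * fourier (x n) ξ) 2 (dualHaar H) :=
      (Lp.memLp (fourier (x n))).mul (hA.memLp_top m n)
    refine (h2.integrable one_le_two).bdd_mul (c := 1)
      (continuous_pairing t).aestronglyMeasurable (Eventually.of_forall fun ξ => ?_)
    exact (norm_pairing t ξ).le

theorem norm_sq_eq_integral {Ω : Type*} [MeasurableSpace Ω] {μ : Measure Ω} (g : Lp ℂ 2 μ) :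
    ‖g‖ ^ 2 = ∫ ω, ‖g ω‖ ^ 2 ∂μ := by
  have h1 := inner_self_eq_norm_sq_to_K (𝕜 := ℂ) g
  rw [L2.inner_def] at h1
  simp only [inner_self_eq_norm_sq_to_K] at h1
  have h2 : ∀ ω, ((‖g ω‖ : ℂ)) ^ 2 = ((‖g ω‖ ^ 2 : ℝ) : ℂ) := fun ω => by push_cast; rfl
  simp only [Complex.coe_algebraMap, h2, integral_complex_ofReal] at h1
  exact_mod_cast h1.symm

theorem hasSum_norm_sq_matConv (hA : IsStable A) (x : Fin N → Ell2 H) (m : Fin M) :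
    HasSum (fun t => ‖matConv A x m t‖ ^ 2)
      (∫ ξ, ‖(transfer A ξ *ᵥ fun n => fourier (x n) ξ) m‖ ^ 2 ∂(dualHaar H)) := by
  have h1 := hasSum_norm_sq_inner_charL2 ((memLp_transfer_mulVec hA x m).toLp _)
  simp only [← matConv_eq_inner hA] at h1
  convert h1 using 1
  rw [norm_sq_eq_integral]
  refine integral_congr_ae ?_
  filter_upwards [(memLp_transfer_mulVec hA x m).coeFn_toLp] with ξ h
  rw [h]

theorem exists_bounds_transfer (hA : IsStable A) :
    ∃ a b : ℝ, 0 < a ∧ 0 ≤ b ∧ ∀ᵐ ξ ∂(dualHaar H), ∀ v : Fin N → ℂ,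
      a * ∑ n, ‖v n‖ ^ 2 ≤ ∑ m, ‖(transfer A ξ *ᵥ v) m‖ ^ 2 ∧
      ∑ m, ‖(transfer A ξ *ᵥ v) m‖ ^ 2 ≤ b * ∑ n, ‖v n‖ ^ 2 := by
  obtain ⟨δ, hδ, hdet⟩ : ∃ δ : ℝ, 0 < δ ∧
      ∀ᵐ ξ ∂(dualHaar H), δ ≤ ((transfer A ξ)ᴴ * transfer A ξ).det.re := by
    have h0 := hA.pos
    rw [stabilityConst, essInf, liminf_eq] at h0
    -- A real essential infimum is a supremum of essential lower bounds, with value `0` if there are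
    -- none; positivity excludes this.
    have hne : {a : ℝ | ∀ᶠ ξ in ae (dualHaar H),
        a ≤ ((transfer A ξ)ᴴ * transfer A ξ).det.re}.Nonempty := by
      by_contra hemp
      rw [Set.not_nonempty_iff_eq_empty] at hemp
      rw [hemp, Real.sSup_empty] at h0
      exact lt_irrefl _ h0
    obtain ⟨δ, hmem, hpos⟩ := exists_lt_of_lt_csSup hne h0
    exact ⟨δ, hpos, hmem⟩
  have hbd : ∀ m n, ∃ K : ℝ, ∀ᵐ ξ ∂(dualHaar H), ‖transfer A ξ m n‖ ≤ K := fun m n =>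
    ⟨_, ae_le_lpNorm_exponent_top (hA.memLp_top m n)⟩
  choose K hK using hbd
  set K2 : ℝ := ∑ m, ∑ n, |K m n|
  have hK2 : ∀ᵐ ξ ∂(dualHaar H), ∀ m n, ‖transfer A ξ m n‖ ≤ K2 := by
    simp only [ae_all_iff]
    intro m n
    filter_upwards [hK m n] with ξ hξ
    refine hξ.trans ((le_abs_self _).trans ?_)
    refine (Finset.single_le_sum (f := fun n => |K m n|) (fun _ _ => abs_nonneg _)
      (Finset.mem_univ n)).trans ?_
    exact Finset.single_le_sum (f := fun m => ∑ n, |K m n|)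
      (fun _ _ => Finset.sum_nonneg fun _ _ => abs_nonneg _) (Finset.mem_univ m)
  obtain ⟨c, hc, hlow⟩ := exists_le_sum_norm_sq_mulVec (ι := Fin M) (κ := Fin N) K2 hδ
  refine ⟨c, Fintype.card (Fin M) * (Fintype.card (Fin N) * K2 ^ 2), hc, by positivity, ?_⟩
  filter_upwards [hdet, hK2] with ξ h1 h2 v
  exact ⟨hlow _ h2 h1 v, sum_norm_sq_mulVec_le h2 v⟩

theorem sum_norm_sq_eq_integral_fourier (x : Fin N → Ell2 H) :
    ∑ n, ‖x n‖ ^ 2 = ∫ ξ, ∑ n, ‖fourier (x n) ξ‖ ^ 2 ∂(dualHaar H) := by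
  rw [integral_finsetSum]
  · exact Finset.sum_congr rfl fun n _ => by
      rw [← norm_sq_eq_integral, LinearIsometry.norm_map]
  · exact fun n _ => (Lp.memLp (fourier (x n))).integrable_norm_pow two_ne_zero

/-- Matrix convolution by a stable matrix is bounded above and below on `ℓ²`. -/
theorem exists_bounds_matConv (hA : IsStable A) :
    ∃ a b : ℝ, 0 < a ∧ 0 ≤ b ∧ ∀ x : Fin N → Ell2 H, ∃ s : ℝ,
      HasSum (fun p : Fin M × H => ‖matConv A x p.1 p.2‖ ^ 2) s ∧
      a * ∑ n, ‖x n‖ ^ 2 ≤ s ∧ s ≤ b * ∑ n, ‖x n‖ ^ 2 := by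
  obtain ⟨a, b, ha, hb, hab⟩ := exists_bounds_transfer hA
  refine ⟨a, b, ha, hb, fun x => ⟨∫ ξ, ∑ m, ‖(transfer A ξ *ᵥ fun n => fourier (x n) ξ) m‖ ^ 2
    ∂(dualHaar H), ?_, ?_, ?_⟩⟩
  · have hs : Summable fun p : Fin M × H => ‖matConv A x p.1 p.2‖ ^ 2 :=
      (summable_prod_of_nonneg fun _ => sq_nonneg _).2
        ⟨fun m => (hasSum_norm_sq_matConv hA x m).summable, Summable.of_finite⟩
    convert hs.hasSum using 1
    rw [hs.tsum_prod' fun m => (hasSum_norm_sq_matConv hA x m).summable, tsum_fintype,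
      integral_finsetSum]
    · exact Finset.sum_congr rfl fun m _ => (hasSum_norm_sq_matConv hA x m).tsum_eq.symm
    · exact fun m _ => (memLp_transfer_mulVec hA x m).integrable_norm_pow two_ne_zero
  · rw [sum_norm_sq_eq_integral_fourier, ← integral_const_mul]
    refine integral_mono_ae ?_ ?_ (hab.mono fun ξ h => (h _).1)
    · exact (integrable_finsetSum _ fun n _ =>
        (Lp.memLp (fourier (x n))).integrable_norm_pow two_ne_zero).const_mul _
    · exact integrable_finsetSum _ fun m _ =>
        (memLp_transfer_mulVec hA x m).integrable_norm_pow two_ne_zero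
  · rw [sum_norm_sq_eq_integral_fourier, ← integral_const_mul]
    refine integral_mono_ae ?_ ?_ (hab.mono fun ξ h => (h _).2)
    · exact integrable_finsetSum _ fun m _ =>
        (memLp_transfer_mulVec hA x m).integrable_norm_pow two_ne_zero
    · exact (integrable_finsetSum _ fun n _ =>
        (Lp.memLp (fourier (x n))).integrable_norm_pow two_ne_zero).const_mul _

end Convolution

/-! ## Square-summable families -/

section Ell2

variable {ι κ H : Type*}

theorem memℓp_two_of_summable {f : ι → ℂ} (hf : Summable fun i => ‖f i‖ ^ 2) : Memℓp f 2 :=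
  memℓp_gen (by simpa using hf)

theorem hasSum_norm_sq_ell2 (x : Ell2 ι) : HasSum (fun i => ‖x i‖ ^ 2) (‖x‖ ^ 2) := by
  simpa using lp.hasSum_norm (p := 2) (by norm_num) x

/-- The `n`-th component of a square-summable family indexed by `κ × H`. -/
def slice (x : Ell2 (κ × H)) (n : κ) : Ell2 H :=
  ⟨fun h => x (n, h), memℓp_two_of_summable ((hasSum_norm_sq_ell2 x).summable.prod_factor n)⟩

theorem slice_apply (x : Ell2 (κ × H)) (n : κ) (h : H) : slice x n h = x (n, h) := rfl

/-- With `exists_slice_eq`, this identifies tuples in `ℓ²(H)` with the Hilbert space `Ell2 (κ × H)`,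
where adjoints are available; the tuple type itself carries the supremum norm. -/
theorem sum_norm_sq_slice [Fintype κ] (x : Ell2 (κ × H)) : ∑ n, ‖slice x n‖ ^ 2 = ‖x‖ ^ 2 := by
  have h1 := (hasSum_norm_sq_ell2 x).prod_fiberwise fun n => hasSum_norm_sq_ell2 (slice x n)
  rw [← h1.tsum_eq, tsum_fintype]

theorem exists_slice_eq [Fintype κ] (x : κ → Ell2 H) : ∃ y : Ell2 (κ × H), slice y = x := by
  have hs : Summable fun p : κ × H => ‖x p.1 p.2‖ ^ 2 :=
    (summable_prod_of_nonneg fun _ => sq_nonneg _).2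
      ⟨fun n => (hasSum_norm_sq_ell2 (x n)).summable, Summable.of_finite⟩
  exact ⟨⟨fun p => x p.1 p.2, memℓp_two_of_summable hs⟩, rfl⟩

theorem hasSum_norm_sq_comp_equiv (e : ι ≃ ι) (x : Ell2 ι) :
    HasSum (fun i => ‖x (e i)‖ ^ 2) (‖x‖ ^ 2) :=
  (Equiv.hasSum_iff e (f := fun i => ‖x i‖ ^ 2)).2 (hasSum_norm_sq_ell2 x)

/-- Composition with a permutation of the index set. -/
def compEquiv (e : ι ≃ ι) (x : Ell2 ι) : Ell2 ι :=
  ⟨fun i => x (e i), memℓp_two_of_summable (hasSum_norm_sq_comp_equiv e x).summable⟩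

theorem compEquiv_apply (e : ι ≃ ι) (x : Ell2 ι) (i : ι) : compEquiv e x i = x (e i) := rfl

/-- Composition with a permutation of the index set, as a unitary operator. -/
def reindex (e : ι ≃ ι) : Ell2 ι ≃ₗᵢ[ℂ] Ell2 ι where
  toFun := compEquiv e
  invFun := compEquiv e.symm
  map_add' _ _ := by ext i; simp [compEquiv_apply]
  map_smul' _ _ := by ext i; simp [compEquiv_apply]
  left_inv x := by ext i; simp [compEquiv_apply]
  right_inv x := by ext i; simp [compEquiv_apply]
  norm_map' x := by
    have h1 : ‖compEquiv e x‖ ^ 2 = ‖x‖ ^ 2 :=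
      (hasSum_norm_sq_ell2 (compEquiv e x)).unique (hasSum_norm_sq_comp_equiv e x)
    exact (sq_eq_sq₀ (norm_nonneg _) (norm_nonneg _)).1 h1

/-- Translation by `k` in the second variable, as a unitary operator. -/
def shift [AddCommGroup H] (k : H) : Ell2 (κ × H) ≃ₗᵢ[ℂ] Ell2 (κ × H) :=
  reindex ((Equiv.refl κ).prodCongr (Equiv.subRight k))

theorem shift_apply [AddCommGroup H] (k : H) (x : Ell2 (κ × H)) (p : κ × H) :
    shift k x p = x (p.1, p.2 - k) := rfl

/-- Every standard basis vector is a translate of one at `0`; this is why finitely many generators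
suffice. -/
theorem shift_single [DecidableEq κ] [DecidableEq H] [AddCommGroup H] (m : κ) (k : H) :
    shift k (lp.single 2 (m, 0) 1 : Ell2 (κ × H)) = lp.single 2 (m, k) 1 := by
  ext ⟨n, h⟩
  rw [shift_apply, lp.single_apply, lp.single_apply]
  simp only [Pi.single_apply, Prod.mk.injEq, sub_eq_zero]

end Ell2

/-! ## The operator of matrix convolution -/

section Convolution

section Algebra

variable {H : Type*} [AddCommGroup H] {M N : ℕ}

theorem matConv_smul (A : Matrix (Fin M) (Fin N) (Ell2 H)) (c : ℂ) (x : Fin N → Ell2 H)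
    (m : Fin M) (t : H) : matConv A (c • x) m t = c * matConv A x m t := by
  simp only [matConv, Pi.smul_apply, lp.coeFn_smul, smul_eq_mul, mul_left_comm, tsum_mul_left,
    ← Finset.mul_sum]

theorem matConv_shift (A : Matrix (Fin M) (Fin N) (Ell2 H)) (k : H) (x : Ell2 (Fin N × H))
    (m : Fin M) (t : H) :
    matConv A (slice (shift k x)) m t = matConv A (slice x) m (t - k) := by
  refine Finset.sum_congr rfl fun n _ => ?_
  rw [← (Equiv.addRight k).tsum_eq]
  refine tsum_congr fun h => ?_
  simp only [slice_apply, shift_apply, Equiv.coe_addRight, add_sub_cancel_right]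
  rw [sub_sub, add_comm k h]

end Algebra

variable {H : Type*} [AddCommGroup H] [TopologicalSpace H] [DiscreteTopology H] {M N : ℕ}
  {A : Matrix (Fin M) (Fin N) (Ell2 H)}

theorem matConv_add (A : Matrix (Fin M) (Fin N) (Ell2 H)) (x y : Fin N → Ell2 H)
    (m : Fin M) (t : H) : matConv A (x + y) m t = matConv A x m t + matConv A y m t := by
  simp only [matConv, Pi.add_apply, lp.coeFn_add, mul_add, ← Finset.sum_add_distrib]
  exact Finset.sum_congr rfl fun n _ =>
    (hasSum_conv _ _ _).summable.tsum_add (hasSum_conv _ _ _).summable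

theorem exists_convolution_operator (hA : IsStable A) :
    ∃ L : Ell2 (Fin N × H) →L[ℂ] Ell2 (Fin M × H),
      (∀ x p, L x p = matConv A (slice x) p.1 p.2) ∧
      ∃ a : ℝ, 0 < a ∧ ∀ x, a * ‖x‖ ^ 2 ≤ ‖L x‖ ^ 2 := by
  obtain ⟨a, b, ha, hb, hab⟩ := exists_bounds_matConv hA
  have hmem : ∀ x : Ell2 (Fin N × H),
      Memℓp (fun p : Fin M × H => matConv A (slice x) p.1 p.2) 2 := fun x =>
    memℓp_two_of_summable (hab (slice x)).choose_spec.1.summable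
  let L₀ : Ell2 (Fin N × H) →ₗ[ℂ] Ell2 (Fin M × H) :=
    { toFun := fun x => ⟨_, hmem x⟩
      map_add' := fun x y => by ext p; exact matConv_add A (slice x) (slice y) p.1 p.2
      map_smul' := fun c x => by ext p; exact matConv_smul A c (slice x) p.1 p.2 }
  have hL : ∀ x, a * ‖x‖ ^ 2 ≤ ‖L₀ x‖ ^ 2 ∧ ‖L₀ x‖ ^ 2 ≤ b * ‖x‖ ^ 2 := by
    intro x
    obtain ⟨s, hs, h1, h2⟩ := hab (slice x)
    rw [(hasSum_norm_sq_ell2 (L₀ x)).unique hs, ← sum_norm_sq_slice]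
    exact ⟨h1, h2⟩
  refine ⟨L₀.mkContinuous (√b) fun x => ?_, fun _ _ => rfl, a, ha, fun x => (hL x).1⟩
  refine (sq_le_sq₀ (norm_nonneg _) (by positivity)).1 ?_
  rw [mul_pow, Real.sq_sqrt hb]
  exact (hL x).2

end Convolution

/-! ## Left inverses and frames in Hilbert spaces -/

section Hilbert

variable {X Y : Type*} [NormedAddCommGroup X] [InnerProductSpace ℂ X] [CompleteSpace X]
  [NormedAddCommGroup Y] [InnerProductSpace ℂ Y] [CompleteSpace Y]

/-- An operator bounded below has a left inverse which intertwines the same unitaries. -/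
theorem exists_equivariant_leftInverse (L : X →L[ℂ] Y) {a : ℝ} (ha : 0 < a)
    (hL : ∀ x, a * ‖x‖ ^ 2 ≤ ‖L x‖ ^ 2) :
    ∃ B : Y →L[ℂ] X, (∀ x, B (L x) = x) ∧
      ∀ (u : X ≃ₗᵢ[ℂ] X) (w : Y ≃ₗᵢ[ℂ] Y), (∀ x, L (u x) = w (L x)) →
        ∀ y, B (w y) = u (B y) := by
  -- `⟨P x, x⟩ = ‖L x‖²` is bounded below by `a ‖x‖²`, so `P` is invertible and `P⁻¹ L†` is a left
  -- inverse of `L`.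
  set P : X →L[ℂ] X := L.adjoint ∘L L with hP
  have hPapp : ∀ x, P x = L.adjoint (L x) := fun _ => rfl
  have hunit : IsUnit P := by
    refine ContinuousLinearMap.isUnit_of_forall_le_norm_inner_map P (c := ⟨a, ha.le⟩) ha
      fun x => ?_
    rw [hPapp, ContinuousLinearMap.adjoint_inner_left, inner_self_eq_norm_sq_to_K]
    have := hL x
    simp only [norm_pow, RCLike.norm_ofReal, abs_norm]
    rw [mul_comm]
    exact this
  obtain ⟨Q, hQ⟩ := hunit
  have hleft : ∀ x, (↑Q⁻¹ : X →L[ℂ] X) (P x) = x := fun x => by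
    rw [← hQ]
    exact DFunLike.congr_fun Q.inv_mul x
  have hright : ∀ x, P ((↑Q⁻¹ : X →L[ℂ] X) x) = x := fun x => by
    rw [← hQ]
    exact DFunLike.congr_fun Q.mul_inv x
  refine ⟨(↑Q⁻¹ : X →L[ℂ] X) ∘L L.adjoint, fun x => hleft x, fun u w huw y => ?_⟩
  -- Taking adjoints in `L u = w L` and using unitarity gives `L† w = u L†`; hence `P` commutes with
  -- `u`, and so does its inverse.
  have hadj : ∀ z, L.adjoint (w z) = u (L.adjoint z) := by
    intro z
    refine ext_inner_right ℂ fun x => ?_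
    obtain ⟨x, rfl⟩ := u.surjective x
    rw [ContinuousLinearMap.adjoint_inner_left, huw, w.inner_map_map, u.inner_map_map,
      ContinuousLinearMap.adjoint_inner_left]
  have h1 : P (u ((↑Q⁻¹ : X →L[ℂ] X) (L.adjoint y))) = L.adjoint (w y) := by
    rw [hPapp, huw, hadj, ← hPapp, hright, hadj]
  change (↑Q⁻¹ : X →L[ℂ] X) (L.adjoint (w y)) = u ((↑Q⁻¹ : X →L[ℂ] X) (L.adjoint y))
  rw [← h1, hleft]

end Hilbert

section Frame

variable {X Y Z : Type*} [NormedAddCommGroup X] [InnerProductSpace ℂ X]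
  [NormedAddCommGroup Y] [InnerProductSpace ℂ Y] [CompleteSpace Y]
  [NormedAddCommGroup Z] [InnerProductSpace ℂ Z] [CompleteSpace Z]

/-- If `D ∘ L` is bounded below, then `D†` is bounded above and below on the range of `D ∘ L`. -/
theorem exists_bounds_adjoint (L : X →L[ℂ] Y) (D : Y →L[ℂ] Z) {c : ℝ} (hc : 0 < c)
    (h : ∀ x, c * ‖x‖ ^ 2 ≤ ‖D (L x)‖ ^ 2) :
    ∃ a b : ℝ, 0 < a ∧ a ≤ b ∧ ∀ x,
      a * ‖D (L x)‖ ^ 2 ≤ ‖D.adjoint (D (L x))‖ ^ 2 ∧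
      ‖D.adjoint (D (L x))‖ ^ 2 ≤ b * ‖D (L x)‖ ^ 2 := by
  have ha : 0 < c / (‖L‖ ^ 2 + 1) := by positivity
  -- The `+ 1` guards against `L = 0`; adding the lower constant to `‖D†‖²` makes the ordering of
  -- the bounds immediate.
  refine ⟨c / (‖L‖ ^ 2 + 1), c / (‖L‖ ^ 2 + 1) + ‖D.adjoint‖ ^ 2, ha,
    le_add_of_nonneg_right (sq_nonneg _), fun x => ⟨?_, ?_⟩⟩
  · set z := D (L x) with hz
    -- Move `D` across `⟨D (L x), z⟩ = ‖z‖²` and apply Cauchy–Schwarz; the hypothesis then bounds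
    -- `‖x‖` by `‖z‖`, and one factor `‖z‖²` cancels.
    have h1 : ‖z‖ ^ 2 ≤ ‖L‖ * ‖x‖ * ‖D.adjoint z‖ := by
      have h2 : ‖z‖ ^ 2 = ‖inner ℂ (L x) (D.adjoint z)‖ := by
        rw [ContinuousLinearMap.adjoint_inner_right, ← hz, inner_self_eq_norm_sq_to_K]
        simp
      rw [h2]
      refine (norm_inner_le_norm _ _).trans ?_
      gcongr
      exact L.le_opNorm x
    rcases eq_or_ne ‖z‖ 0 with h0 | h0
    · rw [h0]
      simp
    · have hzpos : 0 < ‖z‖ ^ 2 := by positivity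
      have h3 : (‖z‖ ^ 2) ^ 2 ≤ (‖L‖ * ‖x‖ * ‖D.adjoint z‖) ^ 2 := by gcongr
      have h4 : c * ‖z‖ ^ 2 * ‖z‖ ^ 2 ≤ (‖L‖ ^ 2 + 1) * ‖D.adjoint z‖ ^ 2 * ‖z‖ ^ 2 := by
        calc c * ‖z‖ ^ 2 * ‖z‖ ^ 2 = c * (‖z‖ ^ 2) ^ 2 := by ring
          _ ≤ c * (‖L‖ * ‖x‖ * ‖D.adjoint z‖) ^ 2 := by gcongr
          _ = ‖L‖ ^ 2 * ‖D.adjoint z‖ ^ 2 * (c * ‖x‖ ^ 2) := by ring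
          _ ≤ (‖L‖ ^ 2 + 1) * ‖D.adjoint z‖ ^ 2 * ‖z‖ ^ 2 := by
            gcongr
            · linarith
            · exact h x
      rw [div_mul_eq_mul_div, div_le_iff₀ (by positivity), mul_comm (‖D.adjoint z‖ ^ 2)]
      exact le_of_mul_le_mul_right h4 hzpos
  · calc ‖D.adjoint (D (L x))‖ ^ 2 ≤ (‖D.adjoint‖ * ‖D (L x)‖) ^ 2 := by
          gcongr
          exact D.adjoint.le_opNorm _
      _ ≤ _ := by
          rw [mul_pow, add_mul]
          exact le_add_of_nonneg_left (by positivity)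

end Frame

/-! ## Synthesis and analysis operators -/

section Operators

variable {ι Ω E : Type*} [NormedAddCommGroup E] [InnerProductSpace ℂ E]

/-- The upper bound on finite sums is a Cauchy criterion for the series; both bounds then survive
passage to the limit. -/
theorem IsRieszSequence.exists_synthesis [CompleteSpace E] {v : ι → E} (hv : IsRieszSequence v) :
    ∃ T : Ell2 ι →L[ℂ] E, (∀ x, HasSum (fun i => x i • v i) (T x)) ∧
      ∃ a : ℝ, 0 < a ∧ ∀ x, a * ‖x‖ ^ 2 ≤ ‖T x‖ ^ 2 := by
  obtain ⟨a, b, ha, hab, h⟩ := hv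
  have hb : 0 < b := ha.trans_le hab
  have hs : ∀ x : Ell2 ι, Summable fun i => x i • v i := by
    intro x
    rw [summable_iff_vanishing_norm]
    intro ε hε
    obtain ⟨s, hs⟩ := summable_iff_vanishing_norm.1 (hasSum_norm_sq_ell2 x).summable
      (ε ^ 2 / b) (by positivity)
    refine ⟨s, fun t ht => lt_of_pow_lt_pow_left₀ 2 hε.le ?_⟩
    have h1 := hs t ht
    rw [Real.norm_of_nonneg (by positivity), lt_div_iff₀ hb, mul_comm] at h1
    exact ((h t x).2).trans_lt h1
  let T₀ : Ell2 ι →ₗ[ℂ] E :=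
    { toFun := fun x => ∑' i, x i • v i
      map_add' := fun x y => by
        simp only [lp.coeFn_add, Pi.add_apply, add_smul]
        exact (hs x).tsum_add (hs y)
      map_smul' := fun c x => by
        simp only [lp.coeFn_smul, Pi.smul_apply, smul_eq_mul, mul_smul, RingHom.id_apply]
        exact (hs x).tsum_const_smul c }
  have hT : ∀ x, HasSum (fun i => x i • v i) (T₀ x) := fun x => (hs x).hasSum
  have hbd : ∀ x, a * ‖x‖ ^ 2 ≤ ‖T₀ x‖ ^ 2 ∧ ‖T₀ x‖ ^ 2 ≤ b * ‖x‖ ^ 2 := by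
    intro x
    have h1 := (Filter.Tendsto.norm (hT x)).pow 2
    have h2 : Tendsto (fun s : Finset ι => ∑ i ∈ s, ‖x i‖ ^ 2) atTop (𝓝 (‖x‖ ^ 2)) :=
      hasSum_norm_sq_ell2 x
    exact ⟨le_of_tendsto_of_tendsto' (h2.const_mul a) h1 fun s => (h s x).1,
      le_of_tendsto_of_tendsto' h1 (h2.const_mul b) fun s => (h s x).2⟩
  refine ⟨T₀.mkContinuous (√b) fun x => ?_, hT, a, ha, fun x => (hbd x).1⟩
  refine (sq_le_sq₀ (norm_nonneg _) (by positivity)).1 ?_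
  rw [mul_pow, Real.sq_sqrt hb.le]
  exact (hbd x).2

theorem eLpNorm_two_sq_eq_lintegral [MeasurableSpace Ω] {μ : Measure Ω} (f : Ω → ℂ) :
    eLpNorm f 2 μ ^ 2 = ∫⁻ ω, ‖f ω‖ₑ ^ 2 ∂μ := by
  have := eLpNorm_nnreal_pow_eq_lintegral (f := f) (μ := μ) (p := 2) two_ne_zero
  simpa using this

theorem IsContinuousFrame.exists_analysis [MeasurableSpace Ω] {μ : Measure Ω} {ψ : Ω → E}
    (hψ : IsContinuousFrame μ ψ) :
    ∃ V : E →L[ℂ] Lp ℂ 2 μ, (∀ f, V f =ᵐ[μ] fun ω => inner ℂ (ψ ω) f) ∧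
      ∃ a : ℝ, 0 < a ∧ ∀ f, a * ‖f‖ ^ 2 ≤ ‖V f‖ ^ 2 := by
  obtain ⟨hmeas, a, b, ha, hab, h⟩ := hψ
  have hb : 0 < b := ha.trans_le hab
  have hmem : ∀ f, MemLp (fun ω => inner ℂ (ψ ω) f) 2 μ := by
    intro f
    refine ⟨(hmeas f).aestronglyMeasurable, ?_⟩
    have h1 : eLpNorm (fun ω => inner ℂ (ψ ω) f) 2 μ ^ 2 < ∞ := by
      rw [eLpNorm_two_sq_eq_lintegral]
      exact (h f).2.trans_lt ENNReal.ofReal_lt_top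
    simpa using h1
  let V₀ : E →ₗ[ℂ] Lp ℂ 2 μ :=
    { toFun := fun f => (hmem f).toLp
      map_add' := fun f g => by
        rw [← MemLp.toLp_add]
        congr 1
        funext ω
        exact inner_add_right _ _ _
      map_smul' := fun c f => by
        rw [RingHom.id_apply, ← MemLp.toLp_const_smul]
        congr 1
        funext ω
        exact inner_smul_right _ _ _ }
  have hnorm : ∀ f, ENNReal.ofReal (‖V₀ f‖ ^ 2) = ∫⁻ ω, ‖(inner ℂ (ψ ω) f : ℂ)‖ₑ ^ 2 ∂μ := by
    intro f
    rw [← eLpNorm_two_sq_eq_lintegral, ENNReal.ofReal_pow (norm_nonneg _)]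
    congr 1
    change ENNReal.ofReal ‖(hmem f).toLp‖ = _
    rw [Lp.norm_toLp, ENNReal.ofReal_toReal (hmem f).eLpNorm_ne_top]
  have hbd : ∀ f, a * ‖f‖ ^ 2 ≤ ‖V₀ f‖ ^ 2 ∧ ‖V₀ f‖ ^ 2 ≤ b * ‖f‖ ^ 2 := by
    intro f
    have h1 := h f
    rw [← hnorm, ENNReal.ofReal_le_ofReal_iff (by positivity),
      ENNReal.ofReal_le_ofReal_iff (by positivity)] at h1
    exact h1
  refine ⟨V₀.mkContinuous (√b) fun f => ?_, fun f => (hmem f).coeFn_toLp, a, ha,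
    fun f => (hbd f).1⟩
  refine (sq_le_sq₀ (norm_nonneg _) (by positivity)).1 ?_
  rw [mul_pow, Real.sq_sqrt hb.le]
  exact (hbd f).2

end Operators

/-! ## Reconstruction -/

section Reconstruction

variable {G E : Type*} [AddCommGroup G] [TopologicalSpace G]
  [NormedAddCommGroup E] [InnerProductSpace ℂ E] (U : UnitaryRep G E)

theorem voice_apply (φ f : E) (t : G) : voice U φ f t = inner ℂ (U t φ) f := rfl

theorem voice_translate (φ f : E) (s t : G) :
    voice U φ (U t f) s = voice U φ f (s - t) := by
  have h1 : U s φ = U t (U (s - t) φ) := by rw [← U.map_add, add_sub_cancel]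
  rw [voice_apply, voice_apply, h1, LinearIsometryEquiv.inner_map_map]

/-- The bound does not depend on `s`: norm convergence in `E` becomes uniform convergence on `G`. -/
theorem norm_voice_le (φ f : E) (s : G) : ‖voice U φ f s‖ ≤ ‖φ‖ * ‖f‖ := by
  rw [voice_apply, ← (U s).norm_map φ]
  exact norm_inner_le_norm _ _

/-- Translation of the coefficients corresponds to the action of the representation. -/
theorem synthesis_shift {N : ℕ} {H : AddSubgroup G} {Φ : Fin N → E}
    {T : Ell2 (Fin N × H) →L[ℂ] E}
    (hT : ∀ x, HasSum (fun p => x p • translates U H Φ p) (T x)) (k : H)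
    (x : Ell2 (Fin N × H)) : T (shift k x) = U (k : G) (T x) := by
  have h1 := (hT x).mapL ((U (k : G)).toContinuousLinearEquiv : E →L[ℂ] E)
  refine (hT (shift k x)).unique ?_
  rw [← ((Equiv.refl (Fin N)).prodCongr (Equiv.addRight k)).hasSum_iff]
  refine h1.congr_fun ?_
  intro p
  simp only [Function.comp_apply, shift_apply, Equiv.prodCongr_apply, Prod.map_fst, Prod.map_snd,
    Equiv.refl_apply, Equiv.coe_addRight, add_sub_cancel_right, Prod.mk.eta, translates,
    AddSubgroup.coe_add, ContinuousLinearEquiv.coe_coe,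
    LinearIsometryEquiv.coe_toContinuousLinearEquiv, map_smul]
  rw [add_comm, U.map_add]

/-- The image of the standard basis of `ℓ²` under an operator is summed against coefficients. -/
theorem hasSum_smul_single {ι : Type*} [DecidableEq ι] (R : Ell2 ι →L[ℂ] E) (y : Ell2 ι) :
    HasSum (fun i => y i • R (lp.single 2 i 1)) (R y) := by
  refine ((lp.hasSum_single ENNReal.ofNat_ne_top y).mapL R).congr_fun fun i => ?_
  rw [← map_smul, ← lp.single_smul, smul_eq_mul, mul_one]

end Reconstruction

end FrameSampling

end

theorem theorem1
    {G : Type*} [AddCommGroup G] [TopologicalSpace G] [IsTopologicalAddGroup G]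
    [LocallyCompactSpace G] [T2Space G] [MeasurableSpace G] [BorelSpace G]
    (μ : Measure G) [μ.IsAddHaarMeasure]
    {E : Type*} [NormedAddCommGroup E] [InnerProductSpace ℂ E] [CompleteSpace E]
    [TopologicalSpace.SeparableSpace E]
    (U : UnitaryRep G E) (φ : E) (hφ : IsContinuousFrame μ fun t => U t φ)
    (H : AddSubgroup G) [Countable H] [DiscreteTopology H]
    {M N : ℕ} (Φ : Fin N → E) (hΦ : IsRieszSequence (translates U H Φ))
    (A : Matrix (Fin M) (Fin N) (Ell2 H)) (hA : IsStable A) :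
    ∃ S : Fin M → G → ℂ,
      (∀ m, S m ∈ voiceSpace U φ H Φ) ∧
      IsFrameInL2 μ (voiceSpace U φ H Φ)
        (fun (p : Fin M × H) (s : G) => S p.1 (s - (p.2 : G))) ∧
      ∀ F ∈ voiceSpace U φ H Φ,
        (∀ s : G, F s = ∑ m, ∑' t : H, sample U φ Φ A F m t * S m (s - (t : G))) ∧
        (∀ s : G, Summable fun p : Fin M × H =>
          ‖sample U φ Φ A F p.1 p.2 * S p.1 (s - (p.2 : G))‖) ∧
        TendstoUniformly
          (fun (I : Finset (Fin M × H)) (s : G) =>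
            ∑ p ∈ I, sample U φ Φ A F p.1 p.2 * S p.1 (s - (p.2 : G))) F atTop ∧
        Tendsto
          (fun I : Finset (Fin M × H) =>
            eLpNorm (fun s : G =>
              F s - ∑ p ∈ I, sample U φ Φ A F p.1 p.2 * S p.1 (s - (p.2 : G))) 2 μ)
          atTop (𝓝 0) := by
  classical
  obtain ⟨L, hL, aL, haL, hLlow⟩ := exists_convolution_operator hA
  obtain ⟨B, hBL, hB⟩ := exists_equivariant_leftInverse L haL hLlow
  obtain ⟨T, hT, aT, haT, hTlow⟩ := hΦ.exists_synthesis
  obtain ⟨V, hV, aV, haV, hVlow⟩ := hφ.exists_analysis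
  have hLshift : ∀ (k : H) x, L (shift k x) = shift k (L x) := by
    intro k x
    ext p
    rw [shift_apply, hL, hL, matConv_shift]
  -- These vectors reconstruct `T x` from the samples `L x`; those at `(m, 0)` define the `S_m`.
  let g : Fin M × H → E := fun p => T (B (lp.single 2 p 1))
  have hg : ∀ p : Fin M × H, g p = U (p.2 : G) (g (p.1, 0)) := by
    rintro ⟨m, k⟩
    simp only [g]
    rw [← shift_single m k, hB (shift k) (shift k) (hLshift k), synthesis_shift U hT]
  have hSg : ∀ (p : Fin M × H) (s : G), voice U φ (g (p.1, 0)) (s - (p.2 : G)) =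
      voice U φ (g p) s := by
    intro p s
    rw [hg p, voice_translate]
  have hmemT : ∀ x, voice U φ (T x) ∈ voiceSpace U φ H Φ := fun x =>
    ⟨T x, ⟨slice x, hT x⟩, rfl⟩
  -- Uniqueness of coefficients identifies the chosen coefficient vector with `x`, so the samples
  -- are the coordinates of `L x`.
  have hrange : ∀ F ∈ voiceSpace U φ H Φ, ∃ x, F = voice U φ (T x) ∧
      ∀ m t, sample U φ Φ A F m t = L x (m, t) := by
    rintro F ⟨f, ⟨x₀, hf⟩, rfl⟩
    obtain ⟨x, rfl⟩ := exists_slice_eq x₀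
    obtain rfl : T x = f := (hT x).unique hf
    refine ⟨x, rfl, fun m t => ?_⟩
    rw [sample, coeff_eq U hφ hΦ ⟨T x, hf, rfl⟩, hL]
  have hVvoice : ∀ f, V f =ᵐ[μ] voice U φ f := hV
  have hVnorm : ∀ f, eLpNorm (voice U φ f) 2 μ = ‖V f‖ₑ := by
    intro f
    rw [Lp.enorm_def]
    exact (eLpNorm_congr_ae (hVvoice f)).symm
  refine ⟨fun m => voice U φ (g (m, 0)), fun m => hmemT _, ⟨?_, ?_, ?_⟩, ?_⟩
  · intro F hF
    obtain ⟨x, rfl, -⟩ := hrange F hF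
    exact (memLp_congr_ae (hVvoice _)).1 (Lp.memLp _)
  · intro p
    simp only [hSg]
    exact hmemT _
  · obtain ⟨a, b, ha, hab, h⟩ := exists_bounds_adjoint L (V ∘L T ∘L B) (mul_pos haV haT) (by
      intro x
      simp only [ContinuousLinearMap.comp_apply, hBL]
      rw [mul_assoc]
      exact (mul_le_mul_of_nonneg_left (hTlow x) haV.le).trans (hVlow _))
    refine ⟨a, b, ha, hab, fun F hF => ?_⟩
    obtain ⟨x, rfl, -⟩ := hrange F hF
    set D := V ∘L T ∘L B with hD
    have hDL : D (L x) = V (T x) := by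
      simp only [hD, ContinuousLinearMap.comp_apply, hBL]
    -- Pairing with the `p`-th translate is pairing with `D e_p`, hence reading off the `p`-th
    -- coordinate of `D†`.
    have h1 : ∀ p : Fin M × H,
        ∫ w, voice U φ (T x) w * conj (voice U φ (g (p.1, 0)) (w - (p.2 : G))) ∂μ =
          (D.adjoint (D (L x))) p := by
      intro p
      have h2 : inner ℂ (V (g p)) (V (T x)) = (D.adjoint (D (L x))) p := by
        change inner ℂ (D (lp.single 2 p 1)) (V (T x)) = _
        rw [← ContinuousLinearMap.adjoint_inner_right, lp.inner_single_left, hDL]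
        simp
      rw [← h2, L2.inner_def]
      refine integral_congr_ae ?_
      filter_upwards [hVvoice (g p), hVvoice (T x)] with w h3 h4
      rw [h3, h4, hSg]
      rfl
    have h2 : ∑' p : Fin M × H, ‖(D.adjoint (D (L x))) p‖ₑ ^ 2 =
        ENNReal.ofReal (‖D.adjoint (D (L x))‖ ^ 2) := by
      have h3 := hasSum_norm_sq_ell2 (D.adjoint (D (L x)))
      rw [← h3.tsum_eq, ENNReal.ofReal_tsum_of_nonneg (fun _ => sq_nonneg _) h3.summable]
      refine tsum_congr fun p => ?_
      rw [ENNReal.ofReal_pow (norm_nonneg _), ofReal_norm]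
    have h3 : eLpNorm (voice U φ (T x)) 2 μ ^ 2 = ENNReal.ofReal (‖D (L x)‖ ^ 2) := by
      rw [hVnorm, hDL, ENNReal.ofReal_pow (norm_nonneg _), ofReal_norm]
    simp only [h1]
    rw [h2, h3, ← ENNReal.ofReal_mul ha.le, ← ENNReal.ofReal_mul (ha.trans_le hab).le]
    exact ⟨ENNReal.ofReal_le_ofReal (h x).1, ENNReal.ofReal_le_ofReal (h x).2⟩
  · intro F hF
    obtain ⟨x, rfl, hsample⟩ := hrange F hF
    simp only [hSg, hsample]
    -- The expansion of `T B` at `L x`, with `B L x = x`.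
    have hsum : HasSum (fun p => L x p • g p) (T x) := by
      have := hasSum_smul_single (T ∘L B) (L x)
      simpa only [ContinuousLinearMap.comp_apply, hBL] using this
    have hpt : ∀ s, HasSum (fun p => L x p * voice U φ (g p) s) (voice U φ (T x) s) := by
      intro s
      refine (hsum.mapL (innerSL ℂ (U s φ))).congr_fun fun p => ?_
      rw [innerSL_apply_apply, inner_smul_right]
      rfl
    have hdiff : ∀ (I : Finset (Fin M × H)) (s : G),
        voice U φ (T x) s - ∑ p ∈ I, L x p * voice U φ (g p) s =
          voice U φ (T x - ∑ p ∈ I, L x p • g p) s := by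
      intro I s
      simp [map_sub, map_sum, Finset.sum_apply]
    have hlim : Tendsto (fun I : Finset (Fin M × H) => T x - ∑ p ∈ I, L x p • g p)
        atTop (𝓝 0) := by
      have := tendsto_const_nhds (x := T x).sub hsum
      simpa using this
    refine ⟨fun s => ?_, fun s => (hpt s).summable.norm, ?_, ?_⟩
    · rw [← (hpt s).tsum_eq, (hpt s).summable.tsum_prod, tsum_fintype]
      exact Finset.sum_congr rfl fun m _ => tsum_congr fun t =>
        congrArg (L x (m, t) * ·) (hSg (m, t) s).symm
    · rw [Metric.tendstoUniformly_iff]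
      intro ε hε
      have h1 := (hlim.norm).const_mul ‖φ‖
      rw [norm_zero, mul_zero] at h1
      filter_upwards [h1.eventually_lt_const hε] with I hI s
      rw [dist_eq_norm, hdiff]
      exact (norm_voice_le U φ _ s).trans_lt hI
    · simp only [hdiff]
      have h1 : Tendsto (fun I : Finset (Fin M × H) => ‖V (T x - ∑ p ∈ I, L x p • g p)‖ₑ)
          atTop (𝓝 ‖V 0‖ₑ) := (V.continuous.enorm.tendsto 0).comp hlim
      rw [map_zero, enorm_zero] at h1
      exact h1.congr fun I => (hVnorm _).symm
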